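/- Let $\mathcal K^d$ be the set of nonempty compact convex subsets (convex bodies) of the Euclidean space $\mathbb R^d$, with the Hausdorff metric. A function $\varphi:\mathcal K^d\to\mathbb R$ is a valuation if $\varphi(K\cup L)+\varphi(K\cap L)=\varphi(K)+\varphi(L)$ whenever $K,L,K\cup L\in\mathcal K^d$, and it is homogeneous of degree $j$ if $\varphi(\lambda K)=\lambda^j\varphi(K)$ for all $\lambda>0$ and $K\in\mathcal K^d$. Let $\mathbf{Val}_j$ be the set of translation invariant, continuous valuations on $\mathcal K^d$ that are homogeneous of degree $j$. The intrinsic volumes $V_0(K),\dots,V_d(K)$ of $K\in\mathcal K^d$ are defined by the Steiner formula $\mathrm{vol}(K+\rho B^d)=\sum_{j=0}^d\rho^{d-j}\kappa_{d-j}V_j(K)$ for all $\rho\ge 0$, where $B^d$ is the closed unit ball and $\kappa_k$ is the volume of the $k$-dimensional unit ball. For $x\in\mathbb R^d$ let $\overline x$ be the closed segment with endpoints $o$ (the origin) and $x$. Let $X$ be a random vector in $\mathbb R^d$ with $\mathbb E\|X\|<\infty$, and let ${\sf Z}_X=\mathbb E\,\overline X$ be the selection expectation of the random segment $\overline X$,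 that is, the closure of the set of all expectations $\mathbb E\,\xi$ of integrable random vectors $\xi$, on the probability space of $X$, with $\xi\in\overline X$ almost surely; this is a convex body. Let $j\in\{1,\dots,d\}$, let $p\ge j$ be an integer, let $X_1,\dots,X_p$ be independent random vectors (on some probability space) with the distribution of $X$, and let $Z_p=\frac1p(\overline X_1+\dots+\overline X_p)$, with Minkowski addition. Then, for every $\varphi\in\mathbf{Val}_j$, the random variable $\varphi(Z_p)$ is integrable and $$\mathbb E\,\varphi(Z_p)=\frac{p!}{p^j(p-j)!}\,\varphi({\sf Z}_X).$$ In particular, $V_j(Z_p)$ is integrable and $\mathbb E\,V_j(Z_p)=\frac{p!}{p^j(p-j)!}\,V_j({\sf Z}_X)$. -/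

import Mathlib

open MeasureTheory ProbabilityTheory
open scoped Pointwise

noncomputable section

namespace RandomZonotope

/-- The Euclidean space of dimension `d`. -/
abbrev E (d : ℕ) : Type := EuclideanSpace ℝ (Fin d)

/-- Real functions on convex bodies (with the Hausdorff metric) that are translation invariant,
continuous valuations. If `K ∪ L` is convex, then `K ∩ L` is automatically a (nonempty) convex
body, so quantifying over the bodies `U = K ∪ L` and `I = K ∩ L` covers all cases. -/
structure IsVal {d : ℕ} (φ : ConvexBody (E d) → ℝ) : Prop where
  valuation : ∀ K L U I : ConvexBody (E d), (U : Set (E d)) = (K : Set (E d)) ∪ L →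
    (I : Set (E d)) = (K : Set (E d)) ∩ L → φ U + φ I = φ K + φ L
  translation_invariant : ∀ (x : E d) (K L : ConvexBody (E d)),
    (L : Set (E d)) = x +ᵥ (K : Set (E d)) → φ L = φ K
  continuous : Continuous φ

/-- Translation invariant, continuous valuations that are homogeneous of degree `j`. -/
structure IsHomVal {d : ℕ} (j : ℕ) (φ : ConvexBody (E d) → ℝ) : Prop extends IsVal φ where
  homogeneous : ∀ (c : ℝ) (K : ConvexBody (E d)), 0 < c → φ (c • K) = c ^ j * φ K

/-- `v 0, …, v d` are the coefficients of `K` in the Steiner formula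
`vol (K + ρ B) = ∑ j ≤ d, ρ ^ (d - j) κ (d - j) (v j)` for all `ρ ≥ 0`, where `B` is the unit ball
and `κ k` the volume of the `k`-dimensional unit ball (and `v j = 0` for `j > d`). -/
def IsSteiner {d : ℕ} (K : ConvexBody (E d)) (v : ℕ → ℝ) : Prop :=
  (∀ ρ : ℝ, 0 ≤ ρ →
    volume.real ((K : Set (E d)) + ρ • Metric.closedBall (0 : E d) 1) =
      ∑ j ∈ Finset.range (d + 1),
        ρ ^ (d - j) * volume.real (Metric.closedBall (0 : E (d - j)) 1) * v j) ∧
  ∀ j, d < j → v j = 0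

open Classical in
/-- The intrinsic volume `V_j(K)`: the `j`-th coefficient of `K` in the Steiner formula. -/
def intrinsicVolume {d : ℕ} (j : ℕ) (K : ConvexBody (E d)) : ℝ :=
  if h : ∃ v, IsSteiner K v then h.choose j else 0

/-- The closed segment with endpoints `0` and `x`, as a convex body. -/
def seg {d : ℕ} (x : E d) : ConvexBody (E d) where
  carrier := segment ℝ 0 x
  convex' := convex_segment 0 x
  isCompact' := by
    rw [segment_eq_image]
    exact isCompact_Icc.image (by fun_prop)
  nonempty' := ⟨0, left_mem_segment ℝ 0 x⟩

/-- The Minkowski mean `(1/p) (seg x₁ + ⋯ + seg x_p)`. -/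
def zonotope {d p : ℕ} (x : Fin p → E d) : ConvexBody (E d) :=
  (1 / (p : ℝ)) • ∑ i, seg (x i)

/-- The selection expectation of a random set `F`: the closure of the set of the expectations of
all integrable selections of `F`. -/
def selectionExpectation {d : ℕ} {Ω : Type*} [MeasurableSpace Ω] (μ : Measure Ω)
    (F : Ω → Set (E d)) : Set (E d) :=
  closure {y | ∃ ξ : Ω → E d, Integrable ξ μ ∧ (∀ᵐ ω ∂μ, ξ ω ∈ F ω) ∧ ∫ ω, ξ ω ∂μ = y}

/-- The zonoid `Z_X`: the selection expectation of the random segment with endpoints `0` and `X`,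
as a convex body. -/
def zonoid {d : ℕ} {Ω : Type*} [MeasurableSpace Ω] {μ : Measure Ω} {X : Ω → E d}
    (hX : Integrable X μ) : ConvexBody (E d) where
  carrier := selectionExpectation μ fun ω => (seg (X ω) : Set (E d))
  convex' := by
    refine Convex.closure ?_
    rintro _ ⟨ξ, hξ, hs, rfl⟩ _ ⟨η, hη, ht, rfl⟩ a b ha hb hab
    refine ⟨fun ω => a • ξ ω + b • η ω, (hξ.smul a).add (hη.smul b), ?_, ?_⟩
    · filter_upwards [hs, ht] with ω h1 h2
      exact (seg (X ω)).convex h1 h2 ha hb hab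
    · have h := integral_add (hξ.smul a) (hη.smul b)
      simp only [Pi.smul_apply, integral_smul] at h
      exact h
  isCompact' := by
    refine (isCompact_closedBall (0 : E d) (∫ ω, ‖X ω‖ ∂μ)).of_isClosed_subset isClosed_closure
      (closure_minimal ?_ Metric.isClosed_closedBall)
    rintro _ ⟨ξ, hξ, hs, rfl⟩
    rw [mem_closedBall_zero_iff]
    refine norm_integral_le_of_norm_le hX.norm ?_
    filter_upwards [hs] with ω h
    have h' : ξ ω ∈ segment ℝ 0 (X ω) := h
    rw [segment_eq_image] at h'
    obtain ⟨t, ht, ht'⟩ := h'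
    simp only [smul_zero, zero_add] at ht'
    rw [← ht', norm_smul, Real.norm_of_nonneg ht.1]
    exact mul_le_of_le_one_left (norm_nonneg _) ht.2
  nonempty' := ⟨0, subset_closure ⟨fun _ => 0, integrable_zero _ _ _,
    Filter.Eventually.of_forall fun ω => left_mem_segment ℝ 0 (X ω), by simp⟩⟩

end RandomZonotope

end

/-!
Let `φ` be a translation invariant continuous valuation. The body `K + [0, (s + t) x]` is the union
of `K + [0, s x]` and a translate of `K + [0, t x]`, which meet in a translate of `K`; so
`s ↦ φ (K + [0, s x]) - φ K` satisfies Cauchy's equation on `[0, ∞)`, and `φ` is affine in the scale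
of each segment summand (`IsVal.add_seg_smul`). If `φ` is moreover homogeneous of degree `j`, only
the terms of degree `j` survive in the resulting expansion (`IsZonotopeHomVal.sum_seg_smul`):
`φ (∑ i ∈ A, s i • seg (x i)) = ∑ I ⊆ A with |I| = j, (∏ i ∈ I, s i) * φ (∑ i ∈ I, seg (x i))`.

The expansion with `s i = 1 / p` reduces the mean of `φ (Z_p)` to `p ^ (-j) * p.choose j` times the
mean of `φ` at the sum of `j` independent segments, and the latter is `j! * φ (Z_X)`
(`IsZonotopeHomVal.integral_sum_seg`). Indeed, if `X` takes finitely many values `v`, with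
probabilities `q v`, then the zonoid is the zonotope `∑ v, q v • seg v` (`zonoid_simpleFunc`), and
its expansion is the sum over `j`-tuples of values that gives the mean, because tuples with a
repetition contribute `0`. The general case follows by approximating `X` with simple random vectors:
the zonoid depends continuously on `X` in `L¹` (`dist_zonoid_le`), and `φ` at a sum of `j` segments
is bounded by a constant times the product of their lengths, which is integrable by independence.

The argument uses homogeneity on zonotopes only. This allows its application to intrinsic volumes
without the Steiner formula for general convex bodies. For `ρ > 0`, the volume of `K + ρ B` is a
translation invariant continuous valuation (`isVal_parallelVolume`), so the volume of `s K + B` is a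
polynomial in `s ≥ 0` for each zonotope `K`, and a comparison of growth bounds its degree by `d`;
this is the Steiner formula for zonotopes (`IsZonotope.exists_isSteiner`). It extends to limits of
zonotopes, in particular to zonoids, because the coefficients of a polynomial of degree at most `d`
are fixed linear combinations of its values at `1, …, d + 1`. The same combinations of parallel
volumes (`interpolatedVolume`) are continuous valuations on all convex bodies and coincide with the
intrinsic volumes where the Steiner formula is available.
-/

open MeasureTheory ProbabilityTheory
open scoped Pointwise

namespace RandomZonotope

variable {d : ℕ}

/-! ### The Hausdorff metric and segments -/

lemma dist_convexBody_le {K L : ConvexBody (E d)} {r : ℝ} (hr : 0 ≤ r)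
    (hKL : ∀ x ∈ K, ∃ y ∈ L, dist x y ≤ r) (hLK : ∀ x ∈ L, ∃ y ∈ K, dist x y ≤ r) :
    dist K L ≤ r :=
  Metric.hausdorffDist_le_of_mem_dist hr hKL hLK

lemma exists_dist_le_dist_convexBody (K L : ConvexBody (E d)) {x : E d} (hx : x ∈ K) :
    ∃ y ∈ L, dist x y ≤ dist K L := by
  obtain ⟨y, hy, h⟩ := L.isCompact.exists_infDist_eq_dist L.nonempty x
  exact ⟨y, hy, h ▸ Metric.infDist_le_hausdorffDist_of_mem hx ConvexBody.hausdorffEDist_ne_top⟩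

lemma dist_add_convexBody_le (K K' L L' : ConvexBody (E d)) :
    dist (K + L) (K' + L') ≤ dist K K' + dist L L' := by
  have key : ∀ K K' L L' : ConvexBody (E d), ∀ x ∈ K + L, ∃ y ∈ K' + L',
      dist x y ≤ dist K K' + dist L L' := by
    rintro K K' L L' _ ⟨k, hk, l, hl, rfl⟩
    obtain ⟨k', hk', h1⟩ := exists_dist_le_dist_convexBody K K' hk
    obtain ⟨l', hl', h2⟩ := exists_dist_le_dist_convexBody L L' hl
    exact ⟨k' + l', Set.add_mem_add hk' hl', (dist_add_add_le _ _ _ _).trans (add_le_add h1 h2)⟩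
  refine dist_convexBody_le (by positivity) (key K K' L L') ?_
  rw [dist_comm K, dist_comm L]
  exact key K' K L' L

instance : ContinuousAdd (ConvexBody (E d)) :=
  ⟨(LipschitzWith.of_dist_le_mul (K := 2) fun p q =>
    (dist_add_convexBody_le p.1 q.1 p.2 q.2).trans (by
      have h1 : dist p.1 q.1 ≤ dist p q := le_max_left _ _
      have h2 : dist p.2 q.2 ≤ dist p q := le_max_right _ _
      push_cast
      linarith)).continuous⟩

lemma mem_seg {x y : E d} : y ∈ seg x ↔ ∃ t ∈ Set.Icc (0 : ℝ) 1, t • x = y := by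
  change y ∈ segment ℝ 0 x ↔ _
  simp [segment_eq_image]

lemma smul_seg (c : ℝ) (x : E d) : c • seg x = seg (c • x) := by
  refine ConvexBody.ext ?_
  ext y
  rw [ConvexBody.coe_smul, Set.mem_smul_set]
  constructor
  · rintro ⟨z, hz, rfl⟩
    obtain ⟨t, ht, rfl⟩ := mem_seg.1 hz
    exact mem_seg.2 ⟨t, ht, smul_comm _ _ _⟩
  · intro h
    obtain ⟨t, ht, rfl⟩ := mem_seg.1 h
    exact ⟨t • x, mem_seg.2 ⟨t, ht, rfl⟩, smul_comm _ _ _⟩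

lemma dist_seg_le (x y : E d) : dist (seg x) (seg y) ≤ dist x y := by
  have key : ∀ x y : E d, ∀ z ∈ seg x, ∃ w ∈ seg y, dist z w ≤ dist x y := by
    intro x y z hz
    obtain ⟨t, ht, rfl⟩ := mem_seg.1 hz
    refine ⟨t • y, mem_seg.2 ⟨t, ht, rfl⟩, ?_⟩
    rw [dist_smul₀, Real.norm_of_nonneg ht.1]
    exact mul_le_of_le_one_left dist_nonneg ht.2
  exact dist_convexBody_le dist_nonneg (key x y) (by rw [dist_comm x]; exact key y x)

@[fun_prop]
lemma continuous_seg : Continuous (seg : E d → ConvexBody (E d)) :=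
  (LipschitzWith.of_dist_le_mul (K := 1) fun x y => by simpa using dist_seg_le x y).continuous

lemma mem_add_seg_smul {K : ConvexBody (E d)} {s : ℝ} (hs : 0 ≤ s) {x y : E d} :
    y ∈ ((K + seg (s • x) : ConvexBody (E d)) : Set (E d)) ↔
      ∃ k ∈ K, ∃ a ∈ Set.Icc 0 s, k + a • x = y := by
  rw [ConvexBody.coe_add, Set.mem_add]
  constructor
  · rintro ⟨k, hk, z, hz, rfl⟩
    obtain ⟨t, ht, rfl⟩ := mem_seg.1 hz
    exact ⟨k, hk, t * s, ⟨mul_nonneg ht.1 hs, mul_le_of_le_one_left hs ht.2⟩, by rw [mul_smul]⟩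
  · rintro ⟨k, hk, a, ha, rfl⟩
    refine ⟨k, hk, a • x, mem_seg.2 ⟨a / s, ⟨div_nonneg ha.1 hs, div_le_one_of_le₀ ha.2 hs⟩, ?_⟩,
      rfl⟩
    rcases hs.eq_or_lt with rfl | hs
    · have : a = 0 := le_antisymm ha.2 ha.1
      simp [this]
    · rw [smul_smul, div_mul_cancel₀ _ hs.ne']

/-- The translate `K + a`. -/
noncomputable def translate (K : ConvexBody (E d)) (a : E d) : ConvexBody (E d) where
  carrier := a +ᵥ (K : Set (E d))
  convex' := K.convex.vadd a
  isCompact' := K.isCompact.vadd a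
  nonempty' := K.nonempty.vadd_set

lemma mem_translate {K : ConvexBody (E d)} {a y : E d} :
    y ∈ (translate K a : Set (E d)) ↔ ∃ k ∈ K, k + a = y := by
  change y ∈ a +ᵥ (K : Set (E d)) ↔ _
  simp [Set.mem_vadd_set, add_comm]

/-! ### Valuations along a segment -/

/-- The body `K + [0, (s + t) x]` is the union of `K + [0, s x]` and a translate of
`K + [0, t x]`, which intersect in a translate of `K`. -/
lemma IsVal.add_seg {φ : ConvexBody (E d) → ℝ} (hφ : IsVal φ) (K : ConvexBody (E d)) (x : E d)
    {s t : ℝ} (hs : 0 ≤ s) (ht : 0 ≤ t) :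
    φ (K + seg ((s + t) • x)) + φ K = φ (K + seg (s • x)) + φ (K + seg (t • x)) := by
  have h := hφ.valuation (K + seg (s • x)) (translate (K + seg (t • x)) (s • x))
    (K + seg ((s + t) • x)) (translate K (s • x)) ?_ ?_
  · rwa [hφ.translation_invariant (s • x) _ (translate (K + seg (t • x)) (s • x)) rfl,
      hφ.translation_invariant (s • x) _ (translate K (s • x)) rfl] at h
  · ext y
    rw [Set.mem_union, mem_add_seg_smul (add_nonneg hs ht), mem_add_seg_smul hs, mem_translate]
    simp_rw [← SetLike.mem_coe (p := K + seg (t • x)), mem_add_seg_smul ht]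
    constructor
    · rintro ⟨k, hk, a, ha, rfl⟩
      rcases le_total a s with h | h
      · exact Or.inl ⟨k, hk, a, ⟨ha.1, h⟩, rfl⟩
      · exact Or.inr ⟨_, ⟨k, hk, a - s, ⟨sub_nonneg.2 h, by linarith [ha.2]⟩, rfl⟩, by module⟩
    · rintro (⟨k, hk, a, ha, rfl⟩ | ⟨_, ⟨k, hk, a, ha, rfl⟩, rfl⟩)
      · exact ⟨k, hk, a, ⟨ha.1, by linarith [ha.2]⟩, rfl⟩
      · exact ⟨k, hk, a + s, ⟨by linarith [ha.1], by linarith [ha.2]⟩, by module⟩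
  · ext y
    rw [Set.mem_inter_iff, mem_add_seg_smul hs, mem_translate, mem_translate]
    simp_rw [← SetLike.mem_coe (p := K + seg (t • x)), mem_add_seg_smul ht]
    constructor
    · rintro ⟨k, hk, rfl⟩
      exact ⟨⟨k, hk, s, ⟨hs, le_rfl⟩, rfl⟩, _, ⟨k, hk, 0, ⟨le_rfl, ht⟩, rfl⟩, by module⟩
    · rintro ⟨⟨k, hk, a, ha, rfl⟩, _, ⟨l, hl, b, hb, rfl⟩, h⟩
      -- `k + (a - s) x = l + b x` with `a - s ≤ 0 ≤ b` lies between `k` and `l`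
      refine ⟨k + (a - s) • x, ?_, by module⟩
      have hlk : l = k + (a - s - b) • x := by
        rw [← sub_eq_zero] at h ⊢
        rw [← h]
        module
      rcases (show 0 ≤ s - a + b by linarith [ha.2, hb.1]).eq_or_lt with h0 | h0
      · have : a - s = 0 := by linarith [ha.2, hb.1]
        simpa [this] using hk
      · have := K.convex hk hl (a := b / (s - a + b)) (b := (s - a) / (s - a + b))
          (div_nonneg hb.1 h0.le) (div_nonneg (by linarith [ha.2]) h0.le) (by field_simp; ring)
        have e : (b / (s - a + b)) • k + ((s - a) / (s - a + b)) • l = k + (a - s) • x := by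
          rw [hlk]
          match_scalars <;> field_simp <;> ring
        rwa [e] at this

/-- A continuous function on `[0, ∞)` that satisfies Cauchy's equation is linear. -/
lemma eq_mul_of_add_of_continuous {g : ℝ → ℝ} (hg : Continuous g)
    (hadd : ∀ s t, 0 ≤ s → 0 ≤ t → g (s + t) = g s + g t) {s : ℝ} (hs : 0 ≤ s) :
    g s = s * g 1 := by
  have hsub : ∀ a b c e : ℝ, 0 ≤ a → 0 ≤ b → 0 ≤ c → 0 ≤ e → a - b = c - e →
      g a - g b = g c - g e := by
    intro a b c e ha hb hc he h
    have := hadd a e ha he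
    rw [show a + e = c + b by linarith, hadd c b hc hb] at this
    linarith
  have hg0 : g 0 = 0 := by simpa using hadd 0 0 le_rfl le_rfl
  -- the odd extension of `g`
  let G : ℝ →+ ℝ := AddMonoidHom.mk' (fun a => g (max a 0) - g (max (-a) 0)) (by
    intro a b
    have := hsub (max (a + b) 0) (max (-(a + b)) 0) (max a 0 + max b 0) (max (-a) 0 + max (-b) 0)
      (by positivity) (by positivity) (by positivity) (by positivity) (by
        have (c : ℝ) : max c 0 = max (-c) 0 + c := by
          rcases le_total c 0 with h | h <;> simp [h]
        linarith [this a, this b, this (a + b)])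
    rw [hadd _ _ (by positivity) (by positivity), hadd _ _ (by positivity) (by positivity)] at this
    linarith)
  have hG : Continuous G := by
    change Continuous fun a => g (max a 0) - g (max (-a) 0)
    fun_prop
  have hGg : ∀ a, 0 ≤ a → G a = g a := by
    intro a ha
    change g (max a 0) - g (max (-a) 0) = g a
    simp [ha, hg0]
  have := (G.toRealLinearMap hG).map_smul s 1
  simpa [hGg s hs, hGg 1 zero_le_one] using this

lemma IsVal.add_seg_smul {φ : ConvexBody (E d) → ℝ} (hφ : IsVal φ) (K : ConvexBody (E d))
    (x : E d) {s : ℝ} (hs : 0 ≤ s) :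
    φ (K + seg (s • x)) = φ K + s * (φ (K + seg x) - φ K) := by
  have hc := hφ.continuous
  have h := eq_mul_of_add_of_continuous (g := fun s => φ (K + seg (s • x)) - φ K)
    (by fun_prop) (fun a b ha hb => by linarith [hφ.add_seg K x ha hb]) hs
  simp only [one_smul] at h
  linarith

/-- The expansion of a translation invariant continuous valuation on sums of dilated segments:
it is affine in each of the dilation factors. -/
lemma IsVal.exists_expansion {ι : Type*} {φ : ConvexBody (E d) → ℝ} (hφ : IsVal φ)
    (x : ι → E d) (A : Finset ι) :
    ∃ c : Finset ι → ConvexBody (E d) → ℝ, ∀ (s : ι → ℝ), (∀ i, 0 ≤ s i) →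
      ∀ K, φ (K + ∑ i ∈ A, seg (s i • x i)) = ∑ I ∈ A.powerset, (∏ i ∈ I, s i) * c I K := by
  classical
  induction A using Finset.induction_on with
  | empty => exact ⟨fun _ K => φ K, fun s _ K => by simp⟩
  | insert a A ha ih =>
    obtain ⟨c, hc⟩ := ih
    refine ⟨fun I K => if a ∈ I then c (I.erase a) (K + seg (x a)) - c (I.erase a) K else c I K,
      fun s hs K => ?_⟩
    rw [Finset.sum_insert ha, Finset.sum_powerset_insert ha,
      add_comm (seg (s a • x a)), ← add_assoc, hφ.add_seg_smul _ _ (hs a), add_right_comm,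
      hc s hs, hc s hs, ← Finset.sum_sub_distrib, Finset.mul_sum]
    congr 1 <;> refine Finset.sum_congr rfl fun I hI => ?_
    · beta_reduce
      rw [if_neg fun h => ha (Finset.mem_powerset.1 hI h)]
    · have haI : a ∉ I := fun h => ha (Finset.mem_powerset.1 hI h)
      beta_reduce
      rw [if_pos (Finset.mem_insert_self _ _), Finset.erase_insert haI, Finset.prod_insert haI]
      ring

/-! ### Homogeneous valuations on zonotopes -/

/-- A zonotope: a finite Minkowski sum of segments with one endpoint at the origin. -/
def IsZonotope (K : ConvexBody (E d)) : Prop :=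
  ∃ (m : ℕ) (x : Fin m → E d), K = ∑ i, seg (x i)

lemma isZonotope_sum {ι : Type*} (A : Finset ι) (x : ι → E d) :
    IsZonotope (∑ i ∈ A, seg (x i)) :=
  ⟨A.card, fun i => x (A.equivFin.symm i), by
    rw [← Finset.sum_coe_sort A, ← A.equivFin.symm.sum_comp]⟩

lemma IsZonotope.smul {K : ConvexBody (E d)} (hK : IsZonotope K) (c : ℝ) :
    IsZonotope (c • K) := by
  obtain ⟨m, x, rfl⟩ := hK
  exact ⟨m, fun i => c • x i, by simp [Finset.smul_sum, smul_seg]⟩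

lemma seg_zero : seg (0 : E d) = 0 := by
  have h := smul_seg 0 (0 : E d)
  rw [smul_zero] at h
  refine h.symm.trans (ConvexBody.ext ?_)
  rw [ConvexBody.coe_smul, Set.zero_smul_set (seg 0).nonempty, ConvexBody.coe_zero]

/-- Translation invariant continuous valuations for which homogeneity of degree `j` is required
on zonotopes only. -/
structure IsZonotopeHomVal (j : ℕ) (φ : ConvexBody (E d) → ℝ) : Prop extends IsVal φ where
  homogeneous : ∀ (c : ℝ) (K : ConvexBody (E d)), 0 < c → IsZonotope K → φ (c • K) = c ^ j * φ K

lemma IsHomVal.isZonotopeHomVal {j : ℕ} {φ : ConvexBody (E d) → ℝ} (hφ : IsHomVal j φ) :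
    IsZonotopeHomVal j φ :=
  ⟨hφ.toIsVal, fun c K hc _ => hφ.homogeneous c K hc⟩

namespace IsZonotopeHomVal

variable {j : ℕ} {φ : ConvexBody (E d) → ℝ}

/-- Homogeneity of degree `j` leaves only the terms of degree `j` in the expansion of `φ` on
zonotopes, and their coefficients are the values of `φ` at the sums of `j` of the segments. -/
lemma sum_seg_smul (hφ : IsZonotopeHomVal j φ) {ι : Type*} (A : Finset ι) (x : ι → E d)
    (s : ι → ℝ) (hs : ∀ i, 0 ≤ s i) :
    φ (∑ i ∈ A, seg (s i • x i)) =
      ∑ I ∈ A.powersetCard j, (∏ i ∈ I, s i) * φ (∑ i ∈ I, seg (x i)) := by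
  classical
  obtain ⟨c, hc⟩ := hφ.exists_expansion x A
  have hc0 : ∀ s : ι → ℝ, (∀ i, 0 ≤ s i) →
      φ (∑ i ∈ A, seg (s i • x i)) = ∑ I ∈ A.powerset, (∏ i ∈ I, s i) * c I 0 := fun s hs => by
    rw [← hc s hs, zero_add]
  have hcj : ∀ s : ι → ℝ, (∀ i, 0 ≤ s i) →
      φ (∑ i ∈ A, seg (s i • x i)) = ∑ I ∈ A.powersetCard j, (∏ i ∈ I, s i) * c I 0 := by
    intro s hs
    set F := φ (∑ i ∈ A, seg (s i • x i)) with hF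
    have hP : ∑ I ∈ A.powerset, Polynomial.monomial I.card ((∏ i ∈ I, s i) * c I 0) =
        Polynomial.monomial j F := by
      refine Polynomial.eq_of_infinite_eval_eq _ _ ((Set.Ioi_infinite (0 : ℝ)).mono fun r hr => ?_)
      have hr : 0 < r := hr
      have h := hc0 (fun i => r * s i) fun i => mul_nonneg hr.le (hs i)
      have h' := hφ.homogeneous r _ hr (isZonotope_sum A fun i => s i • x i)
      simp only [Finset.smul_sum, smul_seg, smul_smul] at h'
      rw [h', ← hF] at h
      simp only [Set.mem_ofPred_eq, Polynomial.eval_finsetSum, Polynomial.eval_monomial]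
      rw [mul_comm F, h]
      refine Finset.sum_congr rfl fun I _ => ?_
      rw [Finset.prod_mul_distrib, Finset.prod_const]
      ring
    have h := congrArg (fun P => Polynomial.coeff P j) hP
    simp only [Polynomial.finsetSum_coeff, Polynomial.coeff_monomial, if_true] at h
    rw [← h, ← Finset.sum_filter, Finset.powersetCard_eq_filter]
  rw [hcj s hs]
  refine Finset.sum_congr rfl fun I hI => ?_
  obtain ⟨hIA, hIj⟩ := Finset.mem_powersetCard.1 hI
  -- the coefficient at `I` is isolated by the indicator function of `I`
  have h := hcj (fun i => if i ∈ I then 1 else 0) fun i => by positivity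
  have hsum : ∑ i ∈ A, seg ((if i ∈ I then (1 : ℝ) else 0) • x i) = ∑ i ∈ I, seg (x i) := by
    rw [← Finset.sum_subset hIA]
    · exact Finset.sum_congr rfl fun i hi => by simp [hi]
    · intro i _ hi
      simp [hi, seg_zero]
  rw [hsum, Finset.sum_eq_single I] at h
  · rw [h, Finset.prod_congr rfl fun i hi => if_pos hi]
    simp
  · intro J hJ hJI
    obtain ⟨i, hiJ, hiI⟩ := Finset.not_subset.1 fun hsub => hJI (Finset.eq_of_subset_of_card_le hsub
      (hIj.le.trans (Finset.mem_powersetCard.1 hJ).2.ge))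
    rw [Finset.prod_eq_zero hiJ (if_neg hiI), zero_mul]
  · exact fun h => absurd hI h

lemma sum_seg (hφ : IsZonotopeHomVal j φ) {ι : Type*} (A : Finset ι) (x : ι → E d) :
    φ (∑ i ∈ A, seg (x i)) = ∑ I ∈ A.powersetCard j, φ (∑ i ∈ I, seg (x i)) := by
  simpa using hφ.sum_seg_smul A x (fun _ => 1) fun _ => zero_le_one

/-- `φ` is positively homogeneous in each of `j` segments. -/
lemma sum_seg_smul_fin (hφ : IsZonotopeHomVal j φ) (x : Fin j → E d) (s : Fin j → ℝ)
    (hs : ∀ i, 0 ≤ s i) : φ (∑ i, seg (s i • x i)) = (∏ i, s i) * φ (∑ i, seg (x i)) := by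
  have h : (Finset.univ : Finset (Fin j)).powersetCard j = {Finset.univ} := by
    simpa using Finset.powersetCard_self (Finset.univ : Finset (Fin j))
  rw [hφ.sum_seg_smul _ _ _ hs, h, Finset.sum_singleton]

/-- Fewer than `j` different segments do not suffice for a term of degree `j`. -/
lemma sum_seg_of_not_injective (hφ : IsZonotopeHomVal j φ) (x : Fin j → E d)
    (hx : ¬ Function.Injective x) : φ (∑ i, seg (x i)) = 0 := by
  classical
  have hcard : (Finset.univ.image x).card < j := by
    refine lt_of_le_of_ne (Finset.card_image_le.trans (by simp)) fun h => hx ?_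
    exact Set.injOn_univ.1 (by simpa using Finset.card_image_iff.1 (h.trans (by simp)))
  rw [Finset.sum_comp seg x]
  have h := hφ.sum_seg_smul (Finset.univ.image x) id
    (fun v => ((Finset.univ.filter fun i => x i = v).card : ℝ)) fun _ => by positivity
  rw [Finset.powersetCard_eq_empty.2 hcard, Finset.sum_empty] at h
  rw [← h]
  congr 1
  refine Finset.sum_congr rfl fun v _ => ?_
  rw [id, ← smul_seg]
  generalize (Finset.univ.filter fun i => x i = v).card = n
  have : ((n : NNReal) • seg v) = n • seg v := Nat.cast_smul_eq_nsmul NNReal n (seg v)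
  rw [← this]
  refine ConvexBody.ext ?_
  rw [ConvexBody.coe_smul', ConvexBody.coe_smul]
  rfl

lemma continuous_sum_seg (hφ : IsZonotopeHomVal j φ) {ι : Type*} (A : Finset ι) :
    Continuous fun x : ι → E d => φ (∑ i ∈ A, seg (x i)) :=
  hφ.continuous.comp (continuous_finsetSum _ fun i _ => continuous_seg.comp (continuous_apply i))

lemma exists_bound (hφ : IsZonotopeHomVal j φ) :
    ∃ C : ℝ, ∀ x : Fin j → E d, |φ (∑ i, seg (x i))| ≤ C * ∏ i, ‖x i‖ := by
  have hK : IsCompact (Set.univ.pi fun _ : Fin j => Metric.closedBall (0 : E d) 1) :=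
    isCompact_univ_pi fun _ => isCompact_closedBall _ _
  obtain ⟨C, hC⟩ := hK.exists_bound_of_continuousOn
    (hφ.continuous_sum_seg Finset.univ).continuousOn
  refine ⟨C, fun x => ?_⟩
  have hx : ∀ i, ‖x i‖ • (‖x i‖⁻¹ • x i) = x i := fun i => by
    rcases eq_or_ne (x i) 0 with h | h
    · simp [h]
    · rw [smul_inv_smul₀ (norm_ne_zero_iff.2 h)]
  have h := hφ.sum_seg_smul_fin (fun i => ‖x i‖⁻¹ • x i) (fun i => ‖x i‖) fun i => norm_nonneg _
  simp only [hx] at h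
  rw [h, abs_mul, Finset.abs_prod, mul_comm]
  simp only [abs_norm]
  refine mul_le_mul_of_nonneg_right (hC _ fun i _ => ?_) (by positivity)
  rw [mem_closedBall_zero_iff, norm_smul, norm_inv, norm_norm]
  exact inv_mul_le_one_of_le₀ le_rfl (norm_nonneg _)

end IsZonotopeHomVal

/-! ### Zonoids of random vectors -/

section Zonoid

open Filter Topology

variable {Ω : Type*} [MeasurableSpace Ω] {μ : Measure Ω} {X X' : Ω → E d}

lemma integrable_smul_of_mem_Icc (hX : Integrable X μ) {t : Ω → ℝ}
    (ht : AEStronglyMeasurable t μ) (ht01 : ∀ᵐ ω ∂μ, t ω ∈ Set.Icc (0 : ℝ) 1) :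
    Integrable (fun ω => t ω • X ω) μ := by
  refine hX.norm.mono' (ht.smul hX.1) ?_
  filter_upwards [ht01] with ω h
  rw [norm_smul, Real.norm_of_nonneg h.1]
  exact mul_le_of_le_one_left (norm_nonneg _) h.2

/-- The selections of the random segment are the products `t X` with a random factor
`t ∈ [0, 1]`. -/
lemma coe_zonoid (hX : Integrable X μ) :
    (zonoid hX : Set (E d)) = closure {y | ∃ t : Ω → ℝ, AEStronglyMeasurable t μ ∧
      (∀ᵐ ω ∂μ, t ω ∈ Set.Icc (0 : ℝ) 1) ∧ ∫ ω, t ω • X ω ∂μ = y} := by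
  change closure _ = _
  congr 1
  ext y
  constructor
  · rintro ⟨ξ, hξ, hs, rfl⟩
    -- the factor is recovered from the selection `ξ` as the coefficient of its projection to `X`
    have h : ∀ᵐ ω ∂μ, inner ℝ (ξ ω) (X ω) / ‖X ω‖ ^ 2 ∈ Set.Icc (0 : ℝ) 1 ∧
        (inner ℝ (ξ ω) (X ω) / ‖X ω‖ ^ 2) • X ω = ξ ω := by
      filter_upwards [hs] with ω hω
      obtain ⟨t, ht, htX⟩ := mem_seg.1 hω
      rcases eq_or_ne (X ω) 0 with h0 | h0
      · simp [← htX, h0]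
      · have : inner ℝ (ξ ω) (X ω) / ‖X ω‖ ^ 2 = t := by
          rw [← htX, real_inner_smul_left, real_inner_self_eq_norm_sq,
            mul_div_cancel_right₀ _ (by positivity)]
        rw [this]
        exact ⟨ht, htX⟩
    refine ⟨fun ω => inner ℝ (ξ ω) (X ω) / ‖X ω‖ ^ 2, ?_, h.mono fun _ h => h.1,
      integral_congr_ae (h.mono fun _ h => h.2)⟩
    exact ((hξ.1.inner hX.1).aemeasurable.div
      (hX.1.norm.aemeasurable.pow_const 2)).aestronglyMeasurable
  · rintro ⟨t, ht, ht01, rfl⟩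
    exact ⟨fun ω => t ω • X ω, integrable_smul_of_mem_Icc hX ht ht01,
      ht01.mono fun ω h => mem_seg.2 ⟨t ω, h, rfl⟩, rfl⟩

lemma dist_zonoid_le (hX : Integrable X μ) (hX' : Integrable X' μ) :
    dist (zonoid hX) (zonoid hX') ≤ ∫ ω, ‖X ω - X' ω‖ ∂μ := by
  rw [← ConvexBody.hausdorffDist_coe, coe_zonoid, coe_zonoid, Metric.hausdorffDist_closure]
  have key : ∀ {X X' : Ω → E d}, Integrable X μ → Integrable X' μ → ∀ t : Ω → ℝ,
      AEStronglyMeasurable t μ → (∀ᵐ ω ∂μ, t ω ∈ Set.Icc (0 : ℝ) 1) →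
      dist (∫ ω, t ω • X ω ∂μ) (∫ ω, t ω • X' ω ∂μ) ≤ ∫ ω, ‖X ω - X' ω‖ ∂μ := by
    intro X X' hX hX' t ht ht01
    rw [dist_eq_norm, ← integral_sub (integrable_smul_of_mem_Icc hX ht ht01)
      (integrable_smul_of_mem_Icc hX' ht ht01)]
    refine norm_integral_le_of_norm_le (hX.sub hX').norm ?_
    filter_upwards [ht01] with ω h
    rw [← smul_sub, norm_smul, Real.norm_of_nonneg h.1]
    exact mul_le_of_le_one_left (norm_nonneg _) h.2
  refine Metric.hausdorffDist_le_of_mem_dist (by positivity) ?_ ?_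
  · rintro _ ⟨t, ht, ht01, rfl⟩
    exact ⟨_, ⟨t, ht, ht01, rfl⟩, key hX hX' t ht ht01⟩
  · rintro _ ⟨t, ht, ht01, rfl⟩
    refine ⟨_, ⟨t, ht, ht01, rfl⟩, ?_⟩
    rw [dist_comm]
    exact key hX hX' t ht ht01

lemma mem_sum_seg {ι : Type*} (A : Finset ι) (x : ι → E d) {y : E d} :
    y ∈ ((∑ i ∈ A, seg (x i) : ConvexBody (E d)) : Set (E d)) ↔
      ∃ t : ι → ℝ, (∀ i, t i ∈ Set.Icc (0 : ℝ) 1) ∧ ∑ i ∈ A, t i • x i = y := by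
  classical
  induction A using Finset.induction_on generalizing y with
  | empty =>
    simp only [Finset.sum_empty, ConvexBody.coe_zero, Set.mem_zero]
    exact ⟨fun h => ⟨fun _ => 0, fun _ => by simp, h.symm⟩, fun ⟨_, _, h⟩ => h.symm⟩
  | insert a A ha ih =>
    rw [Finset.sum_insert ha, ConvexBody.coe_add, Set.mem_add]
    constructor
    · rintro ⟨u, hu, w, hw, rfl⟩
      obtain ⟨r, hr, rfl⟩ := mem_seg.1 hu
      obtain ⟨t, ht, rfl⟩ := ih.1 hw
      refine ⟨Function.update t a r, fun i => ?_, ?_⟩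
      · rcases eq_or_ne i a with rfl | h <;> simp_all
      · rw [Finset.sum_insert ha, Function.update_self]
        congr 1
        refine Finset.sum_congr rfl fun i hi => ?_
        rw [Function.update_of_ne (ne_of_mem_of_not_mem hi ha)]
    · rintro ⟨t, ht, rfl⟩
      rw [Finset.sum_insert ha]
      exact ⟨_, mem_seg.2 ⟨t a, ht a, rfl⟩, _, ih.2 ⟨t, ht, rfl⟩, rfl⟩

open Classical in
/-- The probability that a simple function `s`, under the law `ν`, takes the value `v`. -/
noncomputable def atomMass (ν : Measure (E d)) (s : SimpleFunc (E d) (E d)) (v : E d) : ℝ :=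
  ∫ x, (if s x = v then 1 else 0) ∂ν

lemma atomMass_nonneg (ν : Measure (E d)) (s : SimpleFunc (E d) (E d)) (v : E d) :
    0 ≤ atomMass ν s v :=
  integral_nonneg fun _ => by positivity

lemma aestronglyMeasurable_comp_simpleFunc {α : Type*} [MeasurableSpace α] {μ : Measure α}
    {X : α → E d} (hX : AEMeasurable X μ) (s : SimpleFunc (E d) (E d)) (f : E d → ℝ) :
    AEStronglyMeasurable (fun ω => f (s (X ω))) μ :=
  ((s.map f).measurable.comp_aemeasurable hX).aestronglyMeasurable

open Classical in
/-- The zonoid of a random vector with finitely many values `v` of probabilities `q v` is the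
zonotope with the segments from `0` to `q v • v`. -/
lemma zonoid_simpleFunc [IsProbabilityMeasure μ] (hX : AEMeasurable X μ)
    (s : SimpleFunc (E d) (E d)) (h : Integrable (fun ω => s (X ω)) μ) :
    zonoid h = ∑ v ∈ s.range, seg (atomMass (μ.map X) s v • v) := by
  have hq : ∀ v, atomMass (μ.map X) s v = ∫ ω, (if s (X ω) = v then 1 else 0) ∂μ := fun v => by
    rw [atomMass, integral_map hX]
    exact aestronglyMeasurable_comp_simpleFunc aemeasurable_id s fun w => if w = v then 1 else 0
  have hδ : ∀ v, AEStronglyMeasurable (fun ω => (if s (X ω) = v then 1 else 0 : ℝ)) μ := fun v =>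
    aestronglyMeasurable_comp_simpleFunc hX s fun w => if w = v then 1 else 0
  have hint : ∀ (t : Ω → ℝ) v, AEStronglyMeasurable t μ → (∀ᵐ ω ∂μ, t ω ∈ Set.Icc (0 : ℝ) 1) →
      Integrable (fun ω => t ω * (if s (X ω) = v then 1 else 0)) μ := by
    intro t v ht ht01
    refine (integrable_const (1 : ℝ)).mono' (ht.mul (hδ v)) ?_
    filter_upwards [ht01] with ω h
    split_ifs
    · simpa [abs_of_nonneg h.1] using h.2
    · simp
  have hsum : ∀ t : Ω → ℝ, AEStronglyMeasurable t μ → (∀ᵐ ω ∂μ, t ω ∈ Set.Icc (0 : ℝ) 1) →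
      ∫ ω, t ω • s (X ω) ∂μ =
        ∑ v ∈ s.range, (∫ ω, t ω * (if s (X ω) = v then 1 else 0) ∂μ) • v := by
    intro t ht ht01
    simp_rw [← integral_smul_const]
    rw [← integral_finsetSum _ fun v _ => (hint t v ht ht01).smul_const v]
    refine integral_congr_ae (Eventually.of_forall fun ω => ?_)
    simp only [mul_ite, mul_one, mul_zero, ite_smul, zero_smul]
    rw [Finset.sum_ite_eq, if_pos (s.mem_range_self _)]
  refine ConvexBody.ext ?_
  rw [coe_zonoid, ← (∑ v ∈ s.range, seg (atomMass (μ.map X) s v • v)).isClosed.closure_eq]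
  congr 1
  ext y
  rw [mem_sum_seg]
  constructor
  · rintro ⟨t, ht, ht01, rfl⟩
    have h0 : ∀ v, 0 ≤ ∫ ω, t ω * (if s (X ω) = v then 1 else 0) ∂μ := fun v =>
      integral_nonneg_of_ae (ht01.mono fun ω h => mul_nonneg h.1 (by positivity))
    have h1 : ∀ v, ∫ ω, t ω * (if s (X ω) = v then 1 else 0) ∂μ ≤ atomMass (μ.map X) s v := by
      intro v
      rw [hq]
      refine integral_mono_ae (hint t v ht ht01) ?_ (ht01.mono fun ω h =>
        mul_le_of_le_one_left (by positivity) h.2)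
      simpa using hint (fun _ => 1) v aestronglyMeasurable_const (by simp)
    refine ⟨fun v => (∫ ω, t ω * (if s (X ω) = v then 1 else 0) ∂μ) / atomMass (μ.map X) s v,
      fun v => ⟨div_nonneg (h0 v) (atomMass_nonneg _ _ _),
        div_le_one_of_le₀ (h1 v) (atomMass_nonneg _ _ _)⟩, ?_⟩
    rw [hsum t ht ht01]
    refine Finset.sum_congr rfl fun v _ => ?_
    rw [smul_smul]
    congr 1
    rcases eq_or_ne (atomMass (μ.map X) s v) 0 with h | h
    · rw [h, mul_zero]
      exact le_antisymm (h0 v) (h ▸ h1 v)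
    · exact div_mul_cancel₀ _ h
  · rintro ⟨t, ht, rfl⟩
    have htm := aestronglyMeasurable_comp_simpleFunc hX s t
    refine ⟨fun ω => t (s (X ω)), htm, Eventually.of_forall fun ω => ht _, ?_⟩
    rw [hsum _ htm (Eventually.of_forall fun ω => ht _)]
    refine Finset.sum_congr rfl fun v _ => ?_
    rw [hq, smul_smul, ← integral_const_mul]
    congr 2
    ext ω
    split_ifs with h
    · rw [h]
    · simp

/-- The simple functions that approximate the identity of `E d`. -/
noncomputable def approxId (d n : ℕ) : SimpleFunc (E d) (E d) :=
  SimpleFunc.approxOn id measurable_id Set.univ 0 (Set.mem_univ _) n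

lemma norm_approxId_le (n : ℕ) (x : E d) : ‖approxId d n x‖ ≤ ‖x‖ + ‖x‖ :=
  SimpleFunc.norm_approxOn_zero_le measurable_id (Set.mem_univ _) x n

lemma tendsto_approxId (x : E d) : Tendsto (fun n => approxId d n x) atTop (𝓝 x) :=
  SimpleFunc.tendsto_approxOn measurable_id (Set.mem_univ _) (by simp)

lemma integrable_approxId (hX : Integrable X μ) (n : ℕ) :
    Integrable (fun ω => approxId d n (X ω)) μ :=
  (hX.norm.add hX.norm).mono'
    ((approxId d n).measurable.comp_aemeasurable hX.aemeasurable).aestronglyMeasurable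
    (Eventually.of_forall fun _ => norm_approxId_le n _)

lemma tendsto_zonoid_approxId (hX : Integrable X μ) :
    Tendsto (fun n => zonoid (integrable_approxId hX n)) atTop (𝓝 (zonoid hX)) := by
  rw [tendsto_iff_dist_tendsto_zero]
  refine squeeze_zero (fun _ => dist_nonneg) (fun n => dist_zonoid_le _ _) ?_
  have h := tendsto_integral_of_dominated_convergence (μ := μ)
    (F := fun n ω => ‖approxId d n (X ω) - X ω‖) (f := fun _ => 0)
    (fun ω => ‖X ω‖ + ‖X ω‖ + ‖X ω‖) (fun n => ((integrable_approxId hX n).sub hX).1.norm)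
    ((hX.norm.add hX.norm).add hX.norm)
    (fun n => Eventually.of_forall fun ω => by
      rw [norm_norm]
      exact (norm_sub_le _ _).trans (add_le_add_left (norm_approxId_le n _) _))
    (Eventually.of_forall fun ω => by
      simpa using ((tendsto_approxId (X ω)).sub_const (X ω)).norm)
  simpa using h

/-! ### The expectation of a valuation on independent segments -/

open Classical in
/-- Summation over injective `j`-tuples through their ranges: each `j`-set is the range of
`j!` tuples. -/
lemma sum_piFinset_injective {α : Type*} [DecidableEq α] (R : Finset α) (j : ℕ) (F : Finset α → ℝ) :
    ∑ v ∈ Fintype.piFinset fun _ : Fin j => R,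
      (if Function.Injective v then F (Finset.univ.image v) else 0) =
    (j.factorial : ℝ) * ∑ I ∈ R.powersetCard j, F I := by
  rw [← Finset.sum_filter, ← Finset.sum_fiberwise_of_maps_to
    (g := fun v : Fin j → α => Finset.univ.image v) (t := R.powersetCard j), Finset.mul_sum]
  · refine Finset.sum_congr rfl fun I hI => ?_
    obtain ⟨hIR, hIj⟩ := Finset.mem_powersetCard.1 hI
    rw [Finset.sum_congr rfl fun v hv => by rw [(Finset.mem_filter.1 hv).2], Finset.sum_const,
      nsmul_eq_mul]
    congr 2
    have hcard : Fintype.card (Fin j ↪ I) = j.factorial := by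
      rw [Fintype.card_embedding_eq, Fintype.card_coe, hIj, Fintype.card_fin,
        Nat.descFactorial_self]
    rw [← hcard, ← Finset.card_univ]
    symm
    refine Finset.card_bij (fun e _ k => (e k : α)) (fun e _ => ?_) (fun e _ e' _ h => ?_) ?_
    · have hinj : Function.Injective fun k => (e k : α) :=
        Subtype.val_injective.comp e.injective
      refine Finset.mem_filter.2 ⟨Finset.mem_filter.2 ⟨Fintype.mem_piFinset.2 fun k =>
        hIR (e k).2, hinj⟩, ?_⟩
      refine Finset.eq_of_subset_of_card_le (Finset.image_subset_iff.2 fun k _ => (e k).2) ?_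
      rw [Finset.card_image_of_injective _ hinj, Finset.card_univ, Fintype.card_fin, hIj]
    · ext k
      exact congrFun h k
    · intro v hv
      obtain ⟨hv', rfl⟩ := Finset.mem_filter.1 hv
      have hinj := (Finset.mem_filter.1 hv').2
      exact ⟨⟨fun k => ⟨v k, Finset.mem_image_of_mem v (Finset.mem_univ k)⟩,
        fun k l h => hinj (Subtype.ext_iff.1 h)⟩, Finset.mem_univ _, rfl⟩
  · intro v hv
    obtain ⟨hv, hinj⟩ := Finset.mem_filter.1 hv
    exact Finset.mem_powersetCard.2 ⟨Finset.image_subset_iff.2 fun k _ =>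
      Fintype.mem_piFinset.1 hv k, by simp [Finset.card_image_of_injective _ hinj]⟩

namespace IsZonotopeHomVal

variable {j : ℕ} {φ : ConvexBody (E d) → ℝ}

open Classical in
lemma integral_sum_seg_simpleFunc (hφ : IsZonotopeHomVal j φ) (ν : Measure (E d))
    [IsProbabilityMeasure ν] (s : SimpleFunc (E d) (E d)) :
    ∫ x, φ (∑ i, seg (s (x i))) ∂Measure.pi (fun _ : Fin j => ν) =
      j.factorial * φ (∑ v ∈ s.range, seg (atomMass ν s v • v)) := by
  have hpt : ∀ x : Fin j → E d, φ (∑ i, seg (s (x i))) =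
      ∑ v ∈ Fintype.piFinset fun _ : Fin j => s.range,
        (∏ i, if s (x i) = v i then (1 : ℝ) else 0) * φ (∑ i, seg (v i)) := by
    intro x
    rw [Finset.sum_eq_single (fun i => s (x i))]
    · simp
    · intro v _ hv
      obtain ⟨i, hi⟩ := Function.ne_iff.1 hv
      rw [Finset.prod_eq_zero (Finset.mem_univ i) (if_neg hi.symm), zero_mul]
    · exact fun h => absurd (Fintype.mem_piFinset.2 fun i => s.mem_range_self _) h
  have hint : ∀ v, Integrable (fun x => if s x = v then (1 : ℝ) else 0) ν := fun v =>
    (integrable_const (1 : ℝ)).mono'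
      (aestronglyMeasurable_comp_simpleFunc aemeasurable_id s fun w => if w = v then 1 else 0)
      (Eventually.of_forall fun x => by split_ifs <;> simp)
  simp_rw [hpt]
  rw [integral_finsetSum _ fun v _ => (Integrable.fintype_prod fun i => hint (v i)).mul_const _,
    hφ.sum_seg_smul _ _ _ (atomMass_nonneg ν s), ← sum_piFinset_injective]
  refine Finset.sum_congr rfl fun v _ => ?_
  rw [integral_mul_const, integral_fintype_prod_eq_prod
    (f := fun i x => if s x = v i then (1 : ℝ) else 0)]
  split_ifs with hv
  · rw [Finset.prod_image hv.injOn, Finset.sum_image hv.injOn]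
    rfl
  · rw [hφ.sum_seg_of_not_injective v hv, mul_zero]

lemma integrable_sum_seg (hφ : IsZonotopeHomVal j φ) {ν : Measure (E d)} [IsProbabilityMeasure ν]
    (hν : Integrable id ν) :
    Integrable (fun x => φ (∑ i, seg (x i))) (Measure.pi fun _ : Fin j => ν) := by
  obtain ⟨C, hC⟩ := hφ.exists_bound
  exact ((Integrable.fintype_prod fun _ => hν.norm).const_mul C).mono'
    (hφ.continuous_sum_seg _).aestronglyMeasurable (Eventually.of_forall fun x => hC x)

/-- The mean of `φ` at the sum of `j` independent copies of the random segment. For a simple random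
vector this is the expansion of `φ` at a zonotope; the general case follows by approximation. -/
lemma integral_sum_seg [IsProbabilityMeasure μ] (hφ : IsZonotopeHomVal j φ)
    (hX : Integrable X μ) :
    ∫ x, φ (∑ i, seg (x i)) ∂Measure.pi (fun _ : Fin j => μ.map X) =
      j.factorial * φ (zonoid hX) := by
  have hprob : IsProbabilityMeasure (μ.map X) := Measure.isProbabilityMeasure_map hX.aemeasurable
  have hν : Integrable id (μ.map X) :=
    (integrable_map_measure aestronglyMeasurable_id hX.aemeasurable).2 hX
  obtain ⟨C, hC⟩ := hφ.exists_bound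
  have hcont := hφ.continuous_sum_seg (Finset.univ : Finset (Fin j))
  have h1 := tendsto_integral_of_dominated_convergence
    (μ := Measure.pi (fun _ : Fin j => μ.map X))
    (F := fun n x => φ (∑ i, seg (approxId d n (x i)))) (f := fun x => φ (∑ i, seg (x i)))
    (fun x => |C| * ∏ i, (‖x i‖ + ‖x i‖))
    (fun n => (hcont.measurable.comp (measurable_pi_lambda _ fun i =>
      (approxId d n).measurable.comp (measurable_pi_apply i))).aestronglyMeasurable)
    ((Integrable.fintype_prod fun _ => hν.norm.add hν.norm).const_mul _)
    (fun n => Eventually.of_forall fun x => (hC _).trans <|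
      mul_le_mul (le_abs_self C)
        (Finset.prod_le_prod (fun _ _ => norm_nonneg _) fun _ _ => norm_approxId_le n _)
        (Finset.prod_nonneg fun _ _ => norm_nonneg _) (abs_nonneg _))
    (Eventually.of_forall fun x => (hcont.tendsto x).comp
      (tendsto_pi_nhds.2 fun i => tendsto_approxId (x i)))
  refine tendsto_nhds_unique h1 ?_
  simp_rw [hφ.integral_sum_seg_simpleFunc, ← zonoid_simpleFunc hX.aemeasurable _
    (integrable_approxId hX _)]
  exact ((hφ.continuous.tendsto _).comp (tendsto_zonoid_approxId hX)).const_mul _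

end IsZonotopeHomVal

end Zonoid

/-- The mean of `φ` at the Minkowski mean of `p` independent segments. -/
theorem IsZonotopeHomVal.integral_zonotope {j p : ℕ} {φ : ConvexBody (E d) → ℝ}
    (hφ : IsZonotopeHomVal j φ) {Ω Ω' : Type*} [MeasurableSpace Ω] [MeasurableSpace Ω']
    {μ : Measure Ω} [IsProbabilityMeasure μ] {μ' : Measure Ω'} [IsProbabilityMeasure μ']
    {X : Ω → E d} (hX : Integrable X μ) (hp : 0 < p) (hjp : j ≤ p) {Y : Fin p → Ω' → E d}
    (hYX : ∀ i, IdentDistrib (Y i) X μ' μ) (hY : iIndepFun Y μ') :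
    Integrable (fun ω => φ (zonotope fun i => Y i ω)) μ' ∧
      ∫ ω, φ (zonotope fun i => Y i ω) ∂μ' =
        (p.factorial : ℝ) / ((p : ℝ) ^ j * ((p - j).factorial : ℝ)) * φ (zonoid hX) := by
  have hprob : IsProbabilityMeasure (μ.map X) := Measure.isProbabilityMeasure_map hX.aemeasurable
  have hν : Integrable id (μ.map X) :=
    (integrable_map_measure aestronglyMeasurable_id hX.aemeasurable).2 hX
  have hp' : (0 : ℝ) < p := Nat.cast_pos.2 hp
  have hz : ∀ ω, φ (zonotope fun i => Y i ω) = (1 / (p : ℝ)) ^ j *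
      ∑ I ∈ (Finset.univ : Finset (Fin p)).powersetCard j, φ (∑ i ∈ I, seg (Y i ω)) := fun ω => by
    rw [zonotope, hφ.homogeneous _ _ (by positivity) (isZonotope_sum _ _), hφ.sum_seg]
  have hI : ∀ I ∈ (Finset.univ : Finset (Fin p)).powersetCard j,
      Integrable (fun ω => φ (∑ i ∈ I, seg (Y i ω))) μ' ∧
        ∫ ω, φ (∑ i ∈ I, seg (Y i ω)) ∂μ' = j.factorial * φ (zonoid hX) := by
    intro I hI
    -- the vectors with index in `I` are `j` independent copies of `X`
    let e : Fin j ≃ I := (I.orderIsoOfFin (Finset.mem_powersetCard.1 hI).2).toEquiv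
    have hae : AEMeasurable (fun ω (k : Fin j) => Y (e k) ω) μ' :=
      aemeasurable_pi_lambda _ fun k => (hYX _).aemeasurable_fst
    have hlaw : μ'.map (fun ω (k : Fin j) => Y (e k) ω) = Measure.pi fun _ => μ.map X := by
      refine ((hY.precomp (Subtype.val_injective.comp e.injective)).map_fun_eq_pi_map
        fun k => (hYX _).aemeasurable_fst).trans ?_
      congr 1
      ext1 k
      exact (hYX _).map_eq
    have hsum : ∀ ω, ∑ i ∈ I, seg (Y i ω) = ∑ k, seg (Y (e k) ω) := fun ω => by
      rw [← Finset.sum_coe_sort I, ← e.sum_comp]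
    have hcont := (hφ.continuous_sum_seg (Finset.univ : Finset (Fin j))).aestronglyMeasurable
      (μ := μ'.map (fun ω (k : Fin j) => Y (e k) ω))
    simp_rw [hsum]
    constructor
    · refine (integrable_map_measure hcont hae).1 ?_
      rw [hlaw]
      exact hφ.integrable_sum_seg hν
    · rw [← hφ.integral_sum_seg hX, ← hlaw, integral_map hae hcont]
  simp_rw [hz]
  refine ⟨(integrable_finsetSum _ fun I h => (hI I h).1).const_mul _, ?_⟩
  rw [integral_const_mul, integral_finsetSum _ fun I h => (hI I h).1,
    Finset.sum_congr rfl fun I h => (hI I h).2, Finset.sum_const, Finset.card_powersetCard,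
    Finset.card_univ, Fintype.card_fin, nsmul_eq_mul, Nat.cast_choose ℝ hjp,
    one_div, inv_pow]
  field_simp

/-! ### The volume of parallel bodies -/

open Filter Topology Metric

/-- The volume of the parallel body `K + ρ B`. -/
noncomputable def parallelVolume (ρ : ℝ) (K : ConvexBody (E d)) : ℝ :=
  volume.real (cthickening ρ (K : Set (E d)))

lemma add_smul_closedBall (K : ConvexBody (E d)) {ρ : ℝ} (hρ : 0 ≤ ρ) :
    (K : Set (E d)) + ρ • closedBall (0 : E d) 1 = cthickening ρ (K : Set (E d)) := by
  rw [smul_unitClosedBall_of_nonneg hρ, K.isCompact.add_closedBall_zero hρ]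

lemma mem_cthickening_convexBody {K : ConvexBody (E d)} {ρ : ℝ} (hρ : 0 ≤ ρ) {x : E d} :
    x ∈ cthickening ρ (K : Set (E d)) ↔ infDist x K ≤ ρ := by
  rw [mem_cthickening_iff, infDist, ENNReal.le_ofReal_iff_toReal_le (infEDist_ne_top K.nonempty) hρ]

lemma measure_cthickening_ne_top (K : ConvexBody (E d)) (ρ : ℝ) :
    volume (cthickening ρ (K : Set (E d))) ≠ ⊤ :=
  K.isCompact.cthickening.measure_ne_top

/-- The points at distance `ρ` lie in the boundary of a convex set, which is a null set. -/
lemma ae_infDist_ne (K : ConvexBody (E d)) {ρ : ℝ} (hρ : 0 < ρ) :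
    ∀ᵐ x : E d, infDist x K ≠ ρ := by
  refine measure_mono_null (fun x hx => ?_) ((K.convex.thickening ρ).addHaar_frontier volume)
  have hx : infDist x K = ρ := by simpa using hx
  rw [isOpen_thickening.frontier_eq, closure_thickening hρ]
  refine ⟨(mem_cthickening_convexBody hρ.le).2 hx.le, fun h => ?_⟩
  exact ((mem_thickening_iff_infDist_lt K.nonempty).1 h).ne hx

lemma infDist_le_add_dist (K L : ConvexBody (E d)) (x : E d) :
    infDist x L ≤ infDist x K + dist K L :=
  infDist_le_infDist_add_hausdorffDist ConvexBody.hausdorffEDist_ne_top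

lemma continuous_parallelVolume {ρ : ℝ} (hρ : 0 < ρ) :
    Continuous (parallelVolume ρ : ConvexBody (E d) → ℝ) := by
  refine continuous_iff_continuousAt.2 fun K => ?_
  refine (ENNReal.tendsto_toReal (measure_cthickening_ne_top K ρ)).comp ?_
  refine tendsto_measure_of_ae_tendsto_indicator (𝓝 K) isClosed_cthickening.measurableSet
    (fun _ => isClosed_cthickening.measurableSet) (B := cthickening (ρ + 1) (K : Set (E d)))
    isClosed_cthickening.measurableSet (measure_cthickening_ne_top K _) ?_ ?_
  · filter_upwards [ball_mem_nhds K zero_lt_one] with L hL x hx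
    rw [mem_cthickening_convexBody (by positivity)] at hx ⊢
    linarith [infDist_le_add_dist L K x, mem_ball.1 hL]
  · filter_upwards [ae_infDist_ne K hρ] with x hx
    simp only [mem_cthickening_convexBody hρ.le]
    rcases hx.lt_or_gt with h | h
    · filter_upwards [ball_mem_nhds K (sub_pos.2 h)] with L hL
      have h1 := infDist_le_add_dist K L x
      rw [dist_comm] at h1
      exact iff_of_true (by linarith [mem_ball.1 hL]) h.le
    · filter_upwards [ball_mem_nhds K (sub_pos.2 h)] with L hL
      have h1 := infDist_le_add_dist L K x
      exact iff_of_false (by linarith [mem_ball.1 hL]) h.not_ge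

lemma tendsto_parallelVolume_zero (K : ConvexBody (E d)) :
    Tendsto (fun ρ => parallelVolume ρ K) (𝓝 0) (𝓝 (parallelVolume 0 K)) := by
  rw [parallelVolume, cthickening_zero, K.isClosed.closure_eq]
  exact (ENNReal.tendsto_toReal K.isCompact.measure_ne_top).comp
    (tendsto_measure_cthickening_of_isCompact K.isCompact)

lemma parallelVolume_nonneg (ρ : ℝ) (K : ConvexBody (E d)) : 0 ≤ parallelVolume ρ K :=
  measureReal_nonneg

lemma parallelVolume_mono (K : ConvexBody (E d)) : Monotone fun ρ => parallelVolume ρ K :=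
  fun _ _ h => measureReal_mono (cthickening_mono h _) (measure_cthickening_ne_top K _)

lemma parallelVolume_smul (K : ConvexBody (E d)) {c ρ : ℝ} (hc : 0 < c) (hρ : 0 ≤ ρ) :
    parallelVolume (c * ρ) (c • K) = c ^ d * parallelVolume ρ K := by
  have h : cthickening (c * ρ) ((c • K : ConvexBody (E d)) : Set (E d)) =
      c • cthickening ρ (K : Set (E d)) := by
    rw [← add_smul_closedBall _ (by positivity), ← add_smul_closedBall _ hρ, smul_add, smul_smul,
      ConvexBody.coe_smul]
  rw [parallelVolume, h, measureReal_def, Measure.addHaar_smul, ENNReal.toReal_mul,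
    ENNReal.toReal_ofReal (abs_nonneg _), abs_of_pos (by positivity), finrank_euclideanSpace_fin]
  rfl

/-- If `K ∪ L` is convex, then a segment from `K` to `L` meets `K ∩ L`. Hence the parallel bodies of
`K ∩ L` are the intersections of those of `K` and `L`. -/
lemma isVal_parallelVolume {ρ : ℝ} (hρ : 0 < ρ) :
    IsVal (parallelVolume ρ : ConvexBody (E d) → ℝ) where
  continuous := continuous_parallelVolume hρ
  translation_invariant x K L h := by
    rw [parallelVolume, parallelVolume, ← add_smul_closedBall L hρ.le, h, vadd_add_assoc,
      add_smul_closedBall K hρ.le, measureReal_def, measure_vadd, measureReal_def]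
  valuation K L U I hU hI := by
    have h1 : cthickening ρ (U : Set (E d)) = cthickening ρ K ∪ cthickening ρ L := by
      rw [hU, cthickening_union]
    have h2 : cthickening ρ (I : Set (E d)) = cthickening ρ K ∩ cthickening ρ L := by
      refine Set.Subset.antisymm (Set.subset_inter ?_ ?_) ?_
      · exact cthickening_subset_of_subset _ (hI ▸ Set.inter_subset_left)
      · exact cthickening_subset_of_subset _ (hI ▸ Set.inter_subset_right)
      · rintro x ⟨hK, hL⟩
        rw [ConvexBody.isCompact _ |>.cthickening_eq_biUnion_closedBall hρ.le] at hK hL ⊢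
        simp only [Set.mem_iUnion, exists_prop] at hK hL ⊢
        obtain ⟨k, hk, hxk⟩ := hK
        obtain ⟨l, hl, hxl⟩ := hL
        have hkU : k ∈ (U : Set (E d)) := hU ▸ Or.inl hk
        have hlU : l ∈ (U : Set (E d)) := hU ▸ Or.inr hl
        obtain ⟨z, hz, hzI⟩ := isPreconnected_closed_iff.1
          (convex_segment (𝕜 := ℝ) k l).isPreconnected K L K.isClosed L.isClosed
          (hU ▸ U.convex.segment_subset hkU hlU) ⟨k, left_mem_segment ℝ k l, hk⟩
          ⟨l, right_mem_segment ℝ k l, hl⟩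
        refine ⟨z, hI ▸ hzI, mem_closedBall_comm.1 ?_⟩
        exact (convex_closedBall x ρ).segment_subset (mem_closedBall_comm.1 hxk)
          (mem_closedBall_comm.1 hxl) hz
    rw [parallelVolume, parallelVolume, h1, h2]
    exact measureReal_union_add_inter isClosed_cthickening.measurableSet
      (measure_cthickening_ne_top K _) (measure_cthickening_ne_top L _)

/-! ### The Steiner formula for zonotopes and their limits -/

open Polynomial

/-- The volume of the unit ball of dimension `k`. -/
noncomputable def ballVolume (k : ℕ) : ℝ := volume.real (closedBall (0 : E k) 1)

lemma ballVolume_pos (k : ℕ) : 0 < ballVolume k :=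
  ENNReal.toReal_pos (measure_closedBall_pos _ _ one_pos).ne'
    (isCompact_closedBall _ _).measure_ne_top

/-- It suffices to verify the Steiner formula for parallel bodies of positive distance. -/
lemma isSteiner_of_pos {K : ConvexBody (E d)} {v : ℕ → ℝ}
    (h : ∀ ρ : ℝ, 0 < ρ → parallelVolume ρ K =
      ∑ j ∈ Finset.range (d + 1), ρ ^ (d - j) * ballVolume (d - j) * v j)
    (hv : ∀ j, d < j → v j = 0) : IsSteiner K v := by
  refine ⟨fun ρ hρ => ?_, hv⟩
  rw [add_smul_closedBall K hρ]
  rcases hρ.eq_or_lt with rfl | hρ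
  · have h1 := (tendsto_parallelVolume_zero K).mono_left (nhdsWithin_le_nhds (s := Set.Ioi 0))
    have h2 : Tendsto (fun ρ : ℝ => ∑ j ∈ Finset.range (d + 1),
        ρ ^ (d - j) * ballVolume (d - j) * v j) (𝓝[>] 0)
        (𝓝 (∑ j ∈ Finset.range (d + 1), (0 : ℝ) ^ (d - j) * ballVolume (d - j) * v j)) :=
      (Continuous.tendsto (by fun_prop) 0).mono_left nhdsWithin_le_nhds
    exact tendsto_nhds_unique h1 (h2.congr' (eventually_mem_nhdsWithin.mono fun ρ hρ =>
      (h ρ hρ).symm))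
  · exact h ρ hρ

lemma IsSteiner.parallelVolume_eq {K : ConvexBody (E d)} {v : ℕ → ℝ} (h : IsSteiner K v) {ρ : ℝ}
    (hρ : 0 ≤ ρ) : parallelVolume ρ K =
      ∑ j ∈ Finset.range (d + 1), ρ ^ (d - j) * ballVolume (d - j) * v j := by
  rw [parallelVolume, ← add_smul_closedBall K hρ, h.1 ρ hρ]
  rfl

lemma IsSteiner.smul {K : ConvexBody (E d)} {v : ℕ → ℝ} (h : IsSteiner K v) {c : ℝ} (hc : 0 < c) :
    IsSteiner (c • K) fun j => c ^ j * v j := by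
  refine isSteiner_of_pos (fun ρ hρ => ?_) fun j hj => by simp [h.2 j hj]
  have h1 := parallelVolume_smul K hc (div_pos hρ hc).le
  rw [mul_div_cancel₀ _ hc.ne', h.parallelVolume_eq (div_pos hρ hc).le] at h1
  rw [h1, Finset.mul_sum]
  refine Finset.sum_congr rfl fun j hj => ?_
  have hjd : d = d - j + j := by have := Finset.mem_range.1 hj; omega
  rw [div_pow]
  conv_lhs => rw [show c ^ d = c ^ (d - j) * c ^ j by rw [← pow_add, ← hjd]]
  field_simp

lemma IsZonotope.exists_polynomial {φ : ConvexBody (E d) → ℝ} (hφ : IsVal φ)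
    {K : ConvexBody (E d)} (hK : IsZonotope K) :
    ∃ P : ℝ[X], ∀ s : ℝ, 0 ≤ s → φ (s • K) = P.eval s := by
  obtain ⟨m, x, rfl⟩ := hK
  obtain ⟨c, hc⟩ := hφ.exists_expansion x Finset.univ
  refine ⟨∑ I ∈ (Finset.univ : Finset (Fin m)).powerset, C (c I 0) * X ^ I.card, fun s hs => ?_⟩
  have h := hc (fun _ => s) (fun _ => hs) 0
  rw [zero_add] at h
  simp only [Finset.smul_sum, smul_seg]
  rw [h, eval_finsetSum]
  refine Finset.sum_congr rfl fun I _ => ?_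
  rw [Finset.prod_const, eval_mul, eval_C, eval_pow, eval_X, mul_comm]

/-- The Steiner formula for zonotopes. The volume of `s K + B` is a polynomial in `s`, of degree at
most `d` because it is `O(s ^ d)`, and its reciprocal polynomial at `ρ = 1 / s` is the volume of
`K + ρ B`. -/
lemma IsZonotope.exists_isSteiner {K : ConvexBody (E d)} (hK : IsZonotope K) :
    ∃ v, IsSteiner K v := by
  obtain ⟨P, hP⟩ := hK.exists_polynomial (isVal_parallelVolume one_pos)
  have hscale : ∀ s : ℝ, 0 < s → P.eval s = s ^ d * parallelVolume s⁻¹ K := fun s hs => by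
    rw [← hP s hs.le, ← parallelVolume_smul K hs (inv_pos.2 hs).le, mul_inv_cancel₀ hs.ne']
  have hdeg : P.natDegree ≤ d := by
    by_contra! hlt
    have ht := P.abs_div_tendsto_atTop_atTop_of_degree_gt (X ^ d)
      (by
        rw [degree_X_pow]
        exact lt_of_not_ge fun h => hlt.not_ge (natDegree_le_of_degree_le h))
      (pow_ne_zero _ X_ne_zero)
    obtain ⟨s, hs, hs1⟩ := ((ht.eventually_gt_atTop (parallelVolume 1 K)).and
      (eventually_ge_atTop 1)).exists
    have hs0 : 0 < s := one_pos.trans_le hs1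
    rw [hscale s hs0, eval_pow, eval_X, mul_div_cancel_left₀ _ (by positivity),
      abs_of_nonneg (parallelVolume_nonneg _ _)] at hs
    exact hs.not_ge (parallelVolume_mono K (inv_le_one_of_one_le₀ hs1))
  refine ⟨fun j => if j ≤ d then P.coeff j / ballVolume (d - j) else 0,
    isSteiner_of_pos (fun ρ hρ => ?_) fun j hj => if_neg hj.not_ge⟩
  have h := hscale ρ⁻¹ (inv_pos.2 hρ)
  rw [inv_inv, eval_eq_sum_range' (Nat.lt_succ_of_le hdeg)] at h
  have h' : parallelVolume ρ K = ρ ^ d * ∑ i ∈ Finset.range (d + 1), P.coeff i * ρ⁻¹ ^ i := by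
    rw [h, ← mul_assoc, ← mul_pow, mul_inv_cancel₀ hρ.ne', one_pow, one_mul]
  rw [h', Finset.mul_sum]
  refine Finset.sum_congr rfl fun j hj => ?_
  have hjd : j ≤ d := Nat.lt_succ_iff.1 (Finset.mem_range.1 hj)
  rw [if_pos hjd, mul_assoc, mul_div_cancel₀ _ (ballVolume_pos _).ne', inv_pow]
  conv_lhs => rw [show ρ ^ d = ρ ^ (d - j) * ρ ^ j by rw [← pow_add, Nat.sub_add_cancel hjd]]
  field_simp

/-- The linear combination of parallel volumes, at the distances `1, …, d + 1`, that yields the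
`j`-th Steiner coefficient by Lagrange interpolation. Unlike `intrinsicVolume` it is visibly a
valuation and continuous, without recourse to the Steiner formula for general convex bodies. -/
noncomputable def interpolatedVolume (j : ℕ) (K : ConvexBody (E d)) : ℝ :=
  ∑ i ∈ Finset.range (d + 1),
    (Lagrange.basis (Finset.range (d + 1)) (fun i : ℕ => (i + 1 : ℝ)) i).coeff (d - j) /
      ballVolume (d - j) * parallelVolume (i + 1) K

lemma IsSteiner.eq_interpolatedVolume {K : ConvexBody (E d)} {v : ℕ → ℝ} (h : IsSteiner K v)
    {j : ℕ} (hj : j ≤ d) : v j = interpolatedVolume j K := by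
  set P : ℝ[X] := ∑ k ∈ Finset.range (d + 1), monomial (d - k) (ballVolume (d - k) * v k) with hP
  have hdeg : P.degree < (Finset.range (d + 1)).card := by
    rw [Finset.card_range]
    refine (degree_sum_le _ _).trans_lt ((Finset.sup_lt_iff (WithBot.bot_lt_coe _)).2 fun k _ => ?_)
    exact (degree_monomial_le _ _).trans_lt (by exact_mod_cast (by omega : d - k < d + 1))
  have hinj : Set.InjOn (fun i : ℕ => (i + 1 : ℝ)) (Finset.range (d + 1)) :=
    fun a _ b _ hab => by simpa using hab
  have heval : ∀ i ∈ Finset.range (d + 1), P.eval (i + 1 : ℝ) = parallelVolume (i + 1) K := by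
    intro i _
    rw [h.parallelVolume_eq (by positivity), hP, eval_finsetSum]
    refine Finset.sum_congr rfl fun k _ => ?_
    rw [eval_monomial]
    ring
  have hcoeff : P.coeff (d - j) = ballVolume (d - j) * v j := by
    rw [hP, finsetSum_coeff, Finset.sum_eq_single j]
    · rw [coeff_monomial, if_pos rfl]
    · intro k hk hkj
      rw [coeff_monomial, if_neg]
      have := Finset.mem_range.1 hk
      omega
    · exact fun h => absurd (Finset.mem_range.2 (Nat.lt_succ_of_le hj)) h
  rw [Lagrange.eq_interpolate_of_eval_eq _ hinj hdeg heval, Lagrange.interpolate_apply,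
    finsetSum_coeff] at hcoeff
  simp only [coeff_C_mul] at hcoeff
  rw [eq_div_of_mul_eq (ballVolume_pos (d - j)).ne' ((mul_comm _ _).trans hcoeff.symm),
    interpolatedVolume, Finset.sum_div]
  exact Finset.sum_congr rfl fun i _ => by ring

lemma isVal_interpolatedVolume (j : ℕ) :
    IsVal (interpolatedVolume j : ConvexBody (E d) → ℝ) where
  valuation K L U I hU hI := by
    simp only [interpolatedVolume, ← Finset.sum_add_distrib, ← mul_add]
    refine Finset.sum_congr rfl fun i _ => ?_
    rw [(isVal_parallelVolume (by positivity)).valuation K L U I hU hI]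
  translation_invariant x K L h := by
    simp only [interpolatedVolume]
    refine Finset.sum_congr rfl fun i _ => ?_
    rw [(isVal_parallelVolume (by positivity)).translation_invariant x K L h]
  continuous := continuous_finsetSum _ fun i _ =>
    (continuous_parallelVolume (by positivity)).const_mul _

lemma isZonotopeHomVal_interpolatedVolume {j : ℕ} (hj : j ≤ d) :
    IsZonotopeHomVal j (interpolatedVolume j : ConvexBody (E d) → ℝ) where
  toIsVal := isVal_interpolatedVolume j
  homogeneous c K hc hK := by
    obtain ⟨v, hv⟩ := hK.exists_isSteiner
    rw [← (hv.smul hc).eq_interpolatedVolume hj, hv.eq_interpolatedVolume hj]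

lemma intrinsicVolume_eq_interpolatedVolume {K : ConvexBody (E d)} (h : ∃ v, IsSteiner K v)
    {j : ℕ} (hj : j ≤ d) : intrinsicVolume j K = interpolatedVolume j K := by
  rw [intrinsicVolume, dif_pos h, h.choose_spec.eq_interpolatedVolume hj]

/-- The Steiner formula passes to limits of convex bodies. -/
lemma exists_isSteiner_of_tendsto {K : ℕ → ConvexBody (E d)} {L : ConvexBody (E d)}
    (hK : ∀ n, ∃ v, IsSteiner (K n) v) (hL : Tendsto K atTop (𝓝 L)) : ∃ v, IsSteiner L v := by
  refine ⟨fun j => if j ≤ d then interpolatedVolume j L else 0,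
    isSteiner_of_pos (fun ρ hρ => ?_) fun j hj => if_neg hj.not_ge⟩
  have h1 := ((continuous_parallelVolume hρ).tendsto L).comp hL
  refine tendsto_nhds_unique (h1.congr fun n => ?_) (tendsto_finsetSum _ fun j hj =>
    Tendsto.const_mul _ (?_ : Tendsto (fun n => interpolatedVolume j (K n)) atTop _))
  · obtain ⟨v, hv⟩ := hK n
    rw [Function.comp_apply, hv.parallelVolume_eq hρ.le]
    refine Finset.sum_congr rfl fun j hj => ?_
    rw [hv.eq_interpolatedVolume (Nat.lt_succ_iff.1 (Finset.mem_range.1 hj))]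
  · rw [if_pos (Nat.lt_succ_iff.1 (Finset.mem_range.1 hj))]
    exact ((isVal_interpolatedVolume j).continuous.tendsto L).comp hL

lemma exists_isSteiner_zonoid {Ω : Type*} [MeasurableSpace Ω] {μ : Measure Ω}
    [IsProbabilityMeasure μ] {X : Ω → E d} (hX : Integrable X μ) :
    ∃ v, IsSteiner (zonoid hX) v := by
  refine exists_isSteiner_of_tendsto (fun n => ?_) (tendsto_zonoid_approxId hX)
  rw [zonoid_simpleFunc hX.aemeasurable]
  exact (isZonotope_sum _ _).exists_isSteiner

end RandomZonotope

theorem theorem1 {d : ℕ} {Ω Ω' : Type*} [MeasurableSpace Ω] [MeasurableSpace Ω']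
    (μ : Measure Ω) [IsProbabilityMeasure μ] (μ' : Measure Ω') [IsProbabilityMeasure μ']
    (X : Ω → RandomZonotope.E d) (hX : Integrable X μ)
    (j p : ℕ) (hj : 1 ≤ j) (hjd : j ≤ d) (hjp : j ≤ p)
    (Y : Fin p → Ω' → RandomZonotope.E d)
    (hYX : ∀ i, IdentDistrib (Y i) X μ' μ) (hY : iIndepFun Y μ') :
    (∀ φ : ConvexBody (RandomZonotope.E d) → ℝ, RandomZonotope.IsHomVal j φ →
      Integrable (fun ω => φ (RandomZonotope.zonotope fun i => Y i ω)) μ' ∧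
      ∫ ω, φ (RandomZonotope.zonotope fun i => Y i ω) ∂μ' =
        (p.factorial : ℝ) / ((p : ℝ) ^ j * ((p - j).factorial : ℝ)) *
          φ (RandomZonotope.zonoid hX)) ∧
    (Integrable
        (fun ω => RandomZonotope.intrinsicVolume j
          (RandomZonotope.zonotope fun i => Y i ω)) μ' ∧
      ∫ ω, RandomZonotope.intrinsicVolume j (RandomZonotope.zonotope fun i => Y i ω) ∂μ' =
        (p.factorial : ℝ) / ((p : ℝ) ^ j * ((p - j).factorial : ℝ)) *
          RandomZonotope.intrinsicVolume j (RandomZonotope.zonoid hX)) := by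
  have hp : 0 < p := hj.trans hjp
  refine ⟨fun φ hφ => hφ.isZonotopeHomVal.integral_zonotope hX hp hjp hYX hY, ?_⟩
  have h : ∀ ω, RandomZonotope.intrinsicVolume j (RandomZonotope.zonotope fun i => Y i ω) =
      RandomZonotope.interpolatedVolume j (RandomZonotope.zonotope fun i => Y i ω) := fun ω =>
    RandomZonotope.intrinsicVolume_eq_interpolatedVolume
      ((RandomZonotope.isZonotope_sum _ _).smul _).exists_isSteiner hjd
  simp_rw [h, RandomZonotope.intrinsicVolume_eq_interpolatedVolume
    (RandomZonotope.exists_isSteiner_zonoid hX) hjd]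
  exact (RandomZonotope.isZonotopeHomVal_interpolatedVolume hjd).integral_zonotope hX hp hjp hYX hY
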